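/- Let $m\ge 1$, let $M_1,\dots,M_m$ be (finite-dimensional, Hausdorff, second countable) smooth manifolds, possibly with boundary or corners, and let $c: M_1\times\dots\times M_m\to\mathbb R$ be continuous. A set $S\subseteq M_1\times\dots\times M_m$ is called a *$c$-splitting set* if there are Borel functions $u_i:M_i\to\mathbb R$, $i=1,\dots,m$, such that $$\sum_{i=1}^m u_i(x_i)\le c(x_1,\dots,x_m)\qquad\text{for all }(x_1,\dots,x_m)\in M_1\times\dots\times M_m,$$ with equality whenever $(x_1,\dots,x_m)\in S$. It is called *$c$-cyclically monotone* if for every $N$, all points $(x_1^k,\dots,x_m^k)\in S$, $k=1,\dots,N$ (not necessarily distinct), and all $m$ permutations $\sigma_1,\dots,\sigma_m$ of $\{1,\dots,N\}$, $$\sum_{k=1}^N c(x_1^k,\dots,x_m^k)\le\sum_{k=1}^N c\bigl(x_1^{\sigma_1(k)},\dots,x_m^{\sigma_m(k)}\bigr).$$ **Proposition 2.3.** (a) Let $\gamma$ be a Borel probability measure on $M_1\times\dots\times M_m$ whose marginals $\mu_1,\dots,\mu_m$ are compactly supported. Then $\gamma$ is optimal for its marginals, that is, $\int c\,d\gamma\le\int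 c\,d\eta$ for every Borel probability measure $\eta$ on $M_1\times\dots\times M_m$ with marginals $\mu_1,\dots,\mu_m$, if and only if the support of $\gamma$ is a $c$-splitting set. (b) Every $c$-splitting set is $c$-cyclically monotone. -/

import Mathlib

open MeasureTheory
open scoped ContDiff

namespace MultiMarginal

/-- `γ` is a competitor in the multi-marginal problem with marginals `μ 0, …, μ (m - 1)`: it is a
probability measure on the product whose projection to each factor `M i` is `μ i`. -/
def IsCoupling {m : ℕ} {M : Fin m → Type*} [∀ i, MeasurableSpace (M i)]
    (μ : ∀ i, Measure (M i)) (γ : Measure (∀ i, M i)) : Prop :=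
  IsProbabilityMeasure γ ∧ ∀ i, γ.map (fun x : ∀ j, M j => x i) = μ i

/-- `γ` minimizes `∫ c dγ` among all probability measures with marginals `μ i`. This is used only
for continuous `c` and compactly supported `μ i`, so that `c` is integrable for every competitor. -/
def IsOptimal {m : ℕ} {M : Fin m → Type*} [∀ i, MeasurableSpace (M i)]
    (c : (∀ i, M i) → ℝ) (μ : ∀ i, Measure (M i)) (γ : Measure (∀ i, M i)) : Prop :=
  IsCoupling μ γ ∧ ∀ η : Measure (∀ i, M i), IsCoupling μ η → ∫ x, c x ∂γ ≤ ∫ x, c x ∂η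

/-- `S` is a `c`-splitting set: there are real-valued Borel functions `u i` on `M i` with
`∑ i, u i (x i) ≤ c x` for all `x`, and equality on `S`. -/
def IsSplittingSet {m : ℕ} {M : Fin m → Type*} [∀ i, MeasurableSpace (M i)]
    (c : (∀ i, M i) → ℝ) (S : Set (∀ i, M i)) : Prop :=
  ∃ u : ∀ i, M i → ℝ, (∀ i, Measurable (u i)) ∧
    (∀ x : ∀ i, M i, ∑ i, u i (x i) ≤ c x) ∧
    ∀ x ∈ S, ∑ i, u i (x i) = c x

/-- `S` is `c`-cyclically monotone: for all points `x 0, …, x (N - 1)` of `S` (repetitions are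
allowed) and all permutations `σ 0, …, σ (m - 1)` of the `N` labels, permuting the `j`-th
coordinates by `σ j` does not decrease the total cost. -/
def IsCyclicallyMonotone {m : ℕ} {M : Fin m → Type*}
    (c : (∀ i, M i) → ℝ) (S : Set (∀ i, M i)) : Prop :=
  ∀ (N : ℕ) (x : Fin N → ∀ i, M i), (∀ k, x k ∈ S) → ∀ σ : Fin m → Equiv.Perm (Fin N),
    ∑ k, c (x k) ≤ ∑ k, c (fun j => x (σ j k) j)

end MultiMarginal

/-! If the support splits, `∑ i, u i (x i)` has the same integral against every coupling, equals `c`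
`γ`-almost everywhere and is at most `c` elsewhere, so `γ` is optimal; compactness makes the `u i`
integrable (`IsCoupling.integrable_of_eq_on_support`).

The converse is Kantorovich duality with attained dual, on the product of the compact supports of
the marginals. Hahn–Banach and Riesz representation show that there is no duality gap
(`IsCoupling.exists_isCoupling_integral_eq_superhedgingPrice`). Conjugating and normalizing
near-optimal potentials puts them in a pointwise compact, equicontinuous family. A cluster point
must equal `c` on the support, since a strict inequality there would persist on a set of positive
measure, uniformly along the sequence. The limit potentials extend to the whole manifolds by very
negative values off the supports (`exists_measurable_extension`).

Cyclical monotonicity holds because permuting coordinates only reorders the sum of the potentials.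
-/

namespace MultiMarginal

/-! ### Couplings and integrals of separable sums -/

section Coupling

variable {m : ℕ} {X : Fin m → Type*} [∀ i, MeasurableSpace (X i)]
  {μ : ∀ i, Measure (X i)} {γ : Measure (∀ i, X i)}

theorem IsCoupling.measurePreserving (h : IsCoupling μ γ) (i : Fin m) :
    MeasurePreserving (fun x : ∀ j, X j => x i) γ (μ i) :=
  ⟨measurable_pi_apply i, h.2 i⟩

theorem IsCoupling.isProbabilityMeasure_marginal (h : IsCoupling μ γ) (i : Fin m) :
    IsProbabilityMeasure (μ i) := by
  have := h.1
  rw [← h.2 i]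
  exact Measure.isProbabilityMeasure_map (measurable_pi_apply i).aemeasurable

theorem IsCoupling.integrable_sum (h : IsCoupling μ γ) {u : ∀ i, X i → ℝ}
    (hu : ∀ i, Integrable (u i) (μ i)) : Integrable (fun x => ∑ i, u i (x i)) γ :=
  integrable_finsetSum _ fun i _ => (h.measurePreserving i).integrable_comp_of_integrable (hu i)

theorem IsCoupling.integral_sum (h : IsCoupling μ γ) {u : ∀ i, X i → ℝ}
    (hu : ∀ i, Integrable (u i) (μ i)) :
    ∫ x, ∑ i, u i (x i) ∂γ = ∑ i, ∫ x, u i x ∂μ i := by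
  refine (integral_finsetSum _ fun i _ =>
    (h.measurePreserving i).integrable_comp_of_integrable (hu i)).trans ?_
  refine Finset.sum_congr rfl fun i _ => ?_
  have h' := h.measurePreserving i
  conv_rhs => rw [← h'.map_eq]
  refine (integral_map h'.measurable.aemeasurable ?_).symm
  rw [h'.map_eq]
  exact (hu i).aestronglyMeasurable

end Coupling

/-- Riesz representation on a compact Hausdorff space, for functionals on `C(X, ℝ)`. -/
theorem exists_isFiniteMeasure_of_nonneg {X : Type*} [TopologicalSpace X] [CompactSpace X]
    [T2Space X] [MeasurableSpace X] [BorelSpace X] (g : C(X, ℝ) →ₗ[ℝ] ℝ)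
    (hg : ∀ f, 0 ≤ f → 0 ≤ g f) :
    ∃ η : Measure X, IsFiniteMeasure η ∧ ∀ f : C(X, ℝ), ∫ x, f x ∂η = g f := by
  let Λ : CompactlySupportedContinuousMap X ℝ →ₚ[ℝ] ℝ := PositiveLinearMap.mk₀
    { toFun := fun f => g f.toContinuousMap
      map_add' := fun f f' => g.map_add f.toContinuousMap f'.toContinuousMap
      map_smul' := fun r f => g.map_smul r f.toContinuousMap }
    fun f hf => hg _ fun x => hf x
  refine ⟨RealRMK.rieszMeasure Λ, inferInstance, fun f => ?_⟩
  exact RealRMK.integral_rieszMeasure Λ (CompactlySupportedContinuousMap.continuousMapEquiv f)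

/-! ### Kantorovich duality by Hahn–Banach and Riesz -/

section Duality

variable {m : ℕ} {X : Fin m → Type*} [∀ i, TopologicalSpace (X i)] [∀ i, CompactSpace (X i)]
  [∀ i, MeasurableSpace (X i)] {μ : ∀ i, Measure (X i)} {γ : Measure (∀ i, X i)}

/-- The values `∑ i, ∫ u i dμ i` of the continuous `u` whose sum dominates `f`. -/
def superhedgingValues (μ : ∀ i, Measure (X i)) (f : C(∀ i, X i, ℝ)) : Set ℝ :=
  {r | ∃ u : ∀ i, C(X i, ℝ), (∀ x, f x ≤ ∑ i, u i (x i)) ∧ ∑ i, ∫ x, u i x ∂μ i = r}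

/-- The least cost `∑ i, ∫ u i dμ i` at which a sum of continuous `u i` dominates `f`. -/
noncomputable def superhedgingPrice (μ : ∀ i, Measure (X i)) (f : C(∀ i, X i, ℝ)) : ℝ :=
  sInf (superhedgingValues μ f)

theorem superhedgingValues_nonempty (hm : 0 < m) (f : C(∀ i, X i, ℝ)) :
    (superhedgingValues μ f).Nonempty := by
  -- A single factor carries the whole constant `‖f‖`; this needs `0 < m`.
  refine ⟨_, Function.update 0 ⟨0, hm⟩ (ContinuousMap.const _ ‖f‖), fun x => ?_, rfl⟩
  rw [Finset.sum_eq_single ⟨0, hm⟩]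
  · simpa using (le_abs_self _).trans (f.norm_coe_le_norm x)
  · intro j _ hj
    simp [Function.update_of_ne hj]
  · simp

theorem exists_lt_of_superhedgingPrice_lt (hm : 0 < m) {f : C(∀ i, X i, ℝ)} {r : ℝ}
    (hr : superhedgingPrice μ f < r) : ∃ u : ∀ i, C(X i, ℝ),
      (∀ x, f x ≤ ∑ i, u i (x i)) ∧ ∑ i, ∫ x, u i x ∂μ i < r := by
  obtain ⟨_, ⟨u, hu, rfl⟩, hlt⟩ := exists_lt_of_csInf_lt (superhedgingValues_nonempty hm f) hr
  exact ⟨u, hu, hlt⟩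

variable [∀ i, BorelSpace (X i)]

theorem IsCoupling.integrable_continuousMap (h : IsCoupling μ γ) (i : Fin m) (u : C(X i, ℝ)) :
    Integrable u (μ i) := by
  have := h.isProbabilityMeasure_marginal i
  exact u.continuous.integrable_of_hasCompactSupport (HasCompactSupport.of_compactSpace _)

variable [∀ i, SecondCountableTopology (X i)]

theorem IsCoupling.integral_le_of_mem_superhedgingValues (h : IsCoupling μ γ)
    {f : C(∀ i, X i, ℝ)} {r : ℝ} (hr : r ∈ superhedgingValues μ f) : ∫ x, f x ∂γ ≤ r := by
  obtain ⟨u, hu, rfl⟩ := hr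
  have := h.1
  have hi := fun i => h.integrable_continuousMap i (u i)
  rw [← h.integral_sum hi]
  exact integral_mono
    (f.continuous.integrable_of_hasCompactSupport (HasCompactSupport.of_compactSpace _))
    (h.integrable_sum hi) hu

theorem IsCoupling.bddBelow_superhedgingValues (h : IsCoupling μ γ) (f : C(∀ i, X i, ℝ)) :
    BddBelow (superhedgingValues μ f) :=
  ⟨_, fun _ hr => h.integral_le_of_mem_superhedgingValues hr⟩

theorem IsCoupling.superhedgingPrice_le (h : IsCoupling μ γ) {f : C(∀ i, X i, ℝ)}
    (u : ∀ i, C(X i, ℝ)) (hu : ∀ x, f x ≤ ∑ i, u i (x i)) :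
    superhedgingPrice μ f ≤ ∑ i, ∫ x, u i x ∂μ i :=
  csInf_le (h.bddBelow_superhedgingValues f) ⟨u, hu, rfl⟩

theorem IsCoupling.superhedgingPrice_add_le (hm : 0 < m) (h : IsCoupling μ γ)
    (f g : C(∀ i, X i, ℝ)) :
    superhedgingPrice μ (f + g) ≤ superhedgingPrice μ f + superhedgingPrice μ g := by
  refine le_of_forall_pos_le_add fun ε hε => ?_
  obtain ⟨u, hu, hu'⟩ := exists_lt_of_superhedgingPrice_lt (μ := μ) hm
    (lt_add_of_pos_right (superhedgingPrice μ f) (half_pos hε))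
  obtain ⟨v, hv, hv'⟩ := exists_lt_of_superhedgingPrice_lt (μ := μ) hm
    (lt_add_of_pos_right (superhedgingPrice μ g) (half_pos hε))
  have := h.superhedgingPrice_le (f := f + g) (u + v) fun x => by
    simpa [Finset.sum_add_distrib] using add_le_add (hu x) (hv x)
  simp only [Pi.add_apply, ContinuousMap.add_apply] at this
  rw [Finset.sum_congr rfl fun i _ => integral_add (h.integrable_continuousMap i (u i))
    (h.integrable_continuousMap i (v i)), Finset.sum_add_distrib] at this
  linarith

theorem IsCoupling.superhedgingPrice_smul_le (hm : 0 < m) (h : IsCoupling μ γ) {r : ℝ}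
    (hr : 0 < r) (f : C(∀ i, X i, ℝ)) :
    superhedgingPrice μ (r • f) ≤ r * superhedgingPrice μ f := by
  refine le_of_forall_pos_le_add fun ε hε => ?_
  obtain ⟨u, hu, hu'⟩ := exists_lt_of_superhedgingPrice_lt (μ := μ) hm
    (lt_add_of_pos_right (superhedgingPrice μ f) (div_pos hε hr))
  have := h.superhedgingPrice_le (f := r • f) (r • u) fun x => by
    simpa [← Finset.mul_sum] using mul_le_mul_of_nonneg_left (hu x) hr.le
  simp only [Pi.smul_apply, ContinuousMap.smul_apply, smul_eq_mul, integral_const_mul,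
    ← Finset.mul_sum] at this
  refine this.trans ?_
  have := mul_le_mul_of_nonneg_left hu'.le hr.le
  rwa [mul_add, mul_div_cancel₀ _ hr.ne'] at this

theorem IsCoupling.superhedgingPrice_smul (hm : 0 < m) (h : IsCoupling μ γ) {r : ℝ}
    (hr : 0 < r) (f : C(∀ i, X i, ℝ)) :
    superhedgingPrice μ (r • f) = r * superhedgingPrice μ f := by
  refine (h.superhedgingPrice_smul_le hm hr f).antisymm ?_
  have := h.superhedgingPrice_smul_le hm (inv_pos.2 hr) (r • f)
  rw [inv_smul_smul₀ hr.ne'] at this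
  calc r * superhedgingPrice μ f ≤ r * (r⁻¹ * superhedgingPrice μ (r • f)) :=
        mul_le_mul_of_nonneg_left this hr.le
    _ = _ := mul_inv_cancel_left₀ hr.ne' _

/-- A sublinear functional is the value at `x` of some linear functional below it. -/
theorem exists_linearMap_le_of_sublinear {V : Type*} [AddCommGroup V] [Module ℝ V] (p : V → ℝ)
    (p_hom : ∀ r : ℝ, 0 < r → ∀ x, p (r • x) = r * p x)
    (p_add : ∀ x y, p (x + y) ≤ p x + p y) (x : V) :
    ∃ g : V →ₗ[ℝ] ℝ, g x = p x ∧ ∀ y, g y ≤ p y := by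
  have p0 : p 0 = 0 := by
    have := p_hom 2 two_pos 0
    rw [smul_zero] at this
    linarith
  have H : ∀ r : ℝ, r • x = 0 → (RingHom.id ℝ) r • p x = 0 := by
    intro r hr
    rcases smul_eq_zero.1 hr with rfl | rfl <;> simp [p0]
  obtain ⟨g, hg, hgp⟩ := exists_extension_of_le_sublinear
    (LinearPMap.mkSpanSingleton' x (p x) H) p p_hom p_add (by
      rintro ⟨y, hy⟩
      obtain ⟨r, rfl⟩ := Submodule.mem_span_singleton.1 hy
      rw [LinearPMap.mkSpanSingleton'_apply]
      simp only [RingHom.id_apply, smul_eq_mul]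
      rcases lt_trichotomy r 0 with hr | rfl | hr
      -- For negative `r`, subadditivity gives `0 ≤ p (r • x) + p (-r • x)`.
      · have h1 := p_add (r • x) ((-r) • x)
        rw [← add_smul, add_neg_cancel, zero_smul, p0, p_hom _ (neg_pos.2 hr)] at h1
        linarith
      · simp [p0]
      · exact (p_hom r hr x).ge)
  refine ⟨g, ?_, hgp⟩
  exact (hg ⟨x, Submodule.mem_span_singleton_self x⟩).trans
    (LinearPMap.mkSpanSingleton'_apply_self _ _ H _)

variable [∀ i, T2Space (X i)]

/-- Kantorovich duality on compact spaces, without attainment in the dual. -/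
theorem IsCoupling.exists_isCoupling_integral_eq_superhedgingPrice (hm : 0 < m)
    (h : IsCoupling μ γ) (f : C(∀ i, X i, ℝ)) :
    ∃ η, IsCoupling μ η ∧ ∫ x, f x ∂η = superhedgingPrice μ f := by
  obtain ⟨g, hgf, hg⟩ := exists_linearMap_le_of_sublinear (superhedgingPrice μ)
    (fun r hr f => h.superhedgingPrice_smul hm hr f) (h.superhedgingPrice_add_le hm) f
  -- This one bound gives both positivity of `g` (take `u = 0` and `-f`) and the marginals (take a
  -- function of one coordinate, then its negative).
  have hgle : ∀ (u : ∀ i, C(X i, ℝ)) (f : C(∀ i, X i, ℝ)), (∀ x, f x ≤ ∑ i, u i (x i)) →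
      g f ≤ ∑ i, ∫ x, u i x ∂μ i := fun u f hu => (hg f).trans (h.superhedgingPrice_le u hu)
  obtain ⟨η, hη, hηg⟩ := exists_isFiniteMeasure_of_nonneg g fun f hf => by
    have := hgle 0 (-f) fun x => by simpa using hf x
    simpa using this
  have hproj : ∀ (i : Fin m) (v : C(X i, ℝ)), ∫ x, v (x i) ∂η = ∫ x, v x ∂μ i := by
    intro i
    have key : ∀ v : C(X i, ℝ), ∫ x, v (x i) ∂η ≤ ∫ x, v x ∂μ i := by
      intro v
      have := hgle (Pi.single i v) (v.comp ⟨fun x => x i, continuous_apply i⟩) fun x => by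
        rw [Finset.sum_eq_single i]
        · simp
        · intro j _ hj
          simp [hj]
        · simp
      rw [← hηg, Finset.sum_eq_single i] at this
      · simpa using this
      · intro j _ hj
        simp [hj]
      · simp
    intro v
    refine (key v).antisymm ?_
    have := key (-v)
    simpa [integral_neg] using this
  have hmap : ∀ i, η.map (fun x : ∀ j, X j => x i) = μ i := by
    intro i
    have := h.isProbabilityMeasure_marginal i
    let := TopologicalSpace.metrizableSpaceMetric (X i)
    refine ext_of_forall_integral_eq_of_IsFiniteMeasure fun v => ?_
    rw [integral_map (measurable_pi_apply i).aemeasurable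
      v.continuous.measurable.aestronglyMeasurable]
    exact hproj i v.toContinuousMap
  refine ⟨η, ⟨?_, hmap⟩, by rw [hηg, hgf]⟩
  have := h.isProbabilityMeasure_marginal ⟨0, hm⟩
  rw [← hmap ⟨0, hm⟩] at this
  exact (Measure.isProbabilityMeasure_map_iff (measurable_pi_apply _).aemeasurable).1 this

theorem IsOptimal.exists_continuousMap_integral_lt (hm : 0 < m) {c : (∀ i, X i) → ℝ}
    (hc : Continuous c) (h : IsOptimal c μ γ) {ε : ℝ} (hε : 0 < ε) :
    ∃ u : ∀ i, C(X i, ℝ), (∀ x, ∑ i, u i (x i) ≤ c x) ∧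
      ∫ x, c x ∂γ - ε < ∑ i, ∫ x, u i x ∂μ i := by
  -- Dominating `-c` from above by `u` is the same as staying below `c` with `-u`.
  obtain ⟨η, hη, hηp⟩ := h.1.exists_isCoupling_integral_eq_superhedgingPrice hm (-⟨c, hc⟩)
  have hle := h.2 η hη
  simp only [ContinuousMap.neg_apply, ContinuousMap.coe_mk, integral_neg] at hηp
  obtain ⟨u, hu, hlt⟩ := exists_lt_of_superhedgingPrice_lt (μ := μ) (f := -⟨c, hc⟩)
    (r := -∫ x, c x ∂γ + ε) hm (by linarith)
  refine ⟨-u, fun x => ?_, ?_⟩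
  · have := hu x
    simp only [ContinuousMap.neg_apply, ContinuousMap.coe_mk] at this
    simp only [Pi.neg_apply, ContinuousMap.neg_apply, Finset.sum_neg_distrib]
    linarith
  · simp only [Pi.neg_apply, ContinuousMap.neg_apply, integral_neg, Finset.sum_neg_distrib]
    linarith

end Duality

open Filter Topology

/-! ### Improving potentials by conjugation -/

section Conjugation

variable {m : ℕ} {X : Fin m → Type*} {c : (∀ i, X i) → ℝ} {C : ℝ}

/-- The modulus of continuity of `u` is controlled by that of `c` in the `i`-th variable, uniformly
in the other variables. -/
def HasCostModulus (c : (∀ i, X i) → ℝ) (i : Fin m) (u : X i → ℝ) : Prop :=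
  ∀ x y δ, (∀ z, c (Function.update z i x) ≤ c (Function.update z i y) + δ) → u x ≤ u y + δ

/-- The largest function that can replace `u i` when the other potentials are kept. -/
noncomputable def costConjugate (c : (∀ i, X i) → ℝ) (u : ∀ i, X i → ℝ) (i : Fin m) (x : X i) :
    ℝ :=
  ⨅ z : ∀ i, X i, (c (Function.update z i x) - ∑ j ∈ Finset.univ.erase i, u j (z j))

theorem sum_update_apply (u : ∀ i, X i → ℝ) (z : ∀ i, X i) (i : Fin m) (x : X i) :
    ∑ j, u j (Function.update z i x j) = u i x + ∑ j ∈ Finset.univ.erase i, u j (z j) := by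
  rw [← Finset.add_sum_erase _ _ (Finset.mem_univ i), Function.update_self]
  congr 1
  refine Finset.sum_congr rfl fun j hj => ?_
  rw [Function.update_of_ne (Finset.ne_of_mem_erase hj)]

theorem le_sub_sum_erase {u : ∀ i, X i → ℝ} (hu : ∀ x, ∑ i, u i (x i) ≤ c x) (i : Fin m)
    (x : X i) (z : ∀ i, X i) :
    u i x ≤ c (Function.update z i x) - ∑ j ∈ Finset.univ.erase i, u j (z j) := by
  have := hu (Function.update z i x)
  rw [sum_update_apply] at this
  linarith

theorem costConjugate_le {u : ∀ i, X i → ℝ} (hu : ∀ x, ∑ i, u i (x i) ≤ c x) (i : Fin m)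
    (x : X i) (z : ∀ i, X i) : costConjugate c u i x ≤
      c (Function.update z i x) - ∑ j ∈ Finset.univ.erase i, u j (z j) :=
  ciInf_le ⟨u i x, by rintro _ ⟨z, rfl⟩; exact le_sub_sum_erase hu i x z⟩ z

theorem le_costConjugate [Nonempty (∀ i, X i)] {u : ∀ i, X i → ℝ}
    (hu : ∀ x, ∑ i, u i (x i) ≤ c x) (i : Fin m) (x : X i) : u i x ≤ costConjugate c u i x :=
  le_ciInf fun z => le_sub_sum_erase hu i x z

theorem hasCostModulus_costConjugate [Nonempty (∀ i, X i)] {u : ∀ i, X i → ℝ}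
    (hu : ∀ x, ∑ i, u i (x i) ≤ c x) (i : Fin m) :
    HasCostModulus c i (costConjugate c u i) := by
  intro x y δ h
  rw [← sub_le_iff_le_add]
  refine le_ciInf fun z => ?_
  have h1 := costConjugate_le hu i x z
  have h2 := h z
  linarith

/-- Conjugating one index raises that potential, keeps the sum below `c` and leaves the others
untouched, so moduli already gained survive. -/
theorem exists_hasCostModulus_ge [Nonempty (∀ i, X i)] {u : ∀ i, X i → ℝ}
    (hu : ∀ x, ∑ i, u i (x i) ≤ c x) (s : Finset (Fin m)) :
    ∃ v : ∀ i, X i → ℝ, (∀ i x, u i x ≤ v i x) ∧ (∀ x, ∑ i, v i (x i) ≤ c x) ∧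
      ∀ i ∈ s, HasCostModulus c i (v i) := by
  induction s using Finset.induction_on with
  | empty => exact ⟨u, fun _ _ => le_rfl, hu, by simp⟩
  | insert i s his ih =>
    obtain ⟨v, huv, hv, hmod⟩ := ih
    refine ⟨Function.update v i (costConjugate c v i), fun j x => ?_, fun x => ?_, fun j hj => ?_⟩
    · refine (huv j x).trans ?_
      rcases eq_or_ne j i with rfl | hji
      · simpa using le_costConjugate hv j x
      · simp [Function.update_of_ne hji]
    · have h1 := costConjugate_le hv i (x i) x
      rw [Function.update_eq_self] at h1
      rw [← Finset.add_sum_erase _ _ (Finset.mem_univ i), Function.update_self]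
      have h2 : ∑ j ∈ Finset.univ.erase i, Function.update v i (costConjugate c v i) j (x j) =
          ∑ j ∈ Finset.univ.erase i, v j (x j) := Finset.sum_congr rfl fun j hj => by
        rw [Function.update_of_ne (Finset.ne_of_mem_erase hj)]
      rw [h2]
      linarith
    · rcases eq_or_ne j i with rfl | hji
      · simpa using hasCostModulus_costConjugate hv j
      · rw [Function.update_of_ne hji]
        exact hmod j (Finset.mem_of_mem_insert_of_ne hj hji)

theorem HasCostModulus.le_add {i : Fin m} {u : X i → ℝ} (hu : HasCostModulus c i u)
    (hC : ∀ x, |c x| ≤ C) (x y : X i) : u x ≤ u y + 2 * C := by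
  refine hu x y _ fun z => ?_
  have h1 := abs_le.1 (hC (Function.update z i x))
  have h2 := abs_le.1 (hC (Function.update z i y))
  linarith

theorem HasCostModulus.add_const {i : Fin m} {u : X i → ℝ} (hu : HasCostModulus c i u) (a : ℝ) :
    HasCostModulus c i (fun x => u x + a) := by
  intro x y δ h
  have := hu x y δ h
  linarith

/-- The families of potentials below `c` that are bounded by `R` and whose moduli of continuity are
controlled by `c`. -/
def boundedPotentials (c : (∀ i, X i) → ℝ) (R : ℝ) : Set (∀ i, X i → ℝ) :=
  {v | (∀ i x, v i x ∈ Set.Icc (-R) R) ∧ (∀ x, ∑ i, v i (x i) ≤ c x) ∧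
    ∀ i, HasCostModulus c i (v i)}

/-- Tychonoff for pointwise convergence: every constraint is a closed condition on finitely many
values. -/
theorem isCompact_boundedPotentials (c : (∀ i, X i) → ℝ) (R : ℝ) :
    IsCompact (boundedPotentials c R) := by
  have hbox : IsCompact (Set.univ.pi fun i => Set.univ.pi fun _ : X i => Set.Icc (-R) R) :=
    isCompact_univ_pi fun i => isCompact_univ_pi fun _ => isCompact_Icc
  refine hbox.of_isClosed_subset ?_ fun v hv i _ x _ => hv.1 i x
  have happ : ∀ i (x : X i), Continuous fun v : ∀ i, X i → ℝ => v i x := fun i x => by fun_prop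
  simp only [boundedPotentials, HasCostModulus, Set.ofPred_and, Set.ofPred_forall]
  refine IsClosed.inter ?_ (IsClosed.inter ?_ ?_)
  · exact isClosed_iInter fun i => isClosed_iInter fun x => isClosed_Icc.preimage (happ i x)
  · exact isClosed_iInter fun x =>
      isClosed_le (continuous_finsetSum _ fun i _ => happ i (x i)) continuous_const
  · exact isClosed_iInter fun i => isClosed_iInter fun x => isClosed_iInter fun y =>
      isClosed_iInter fun δ => isClosed_iInter fun _ =>
        isClosed_le (happ i x) ((happ i y).add continuous_const)

theorem exists_mem_boundedPotentials_ge (hm : 0 < m) (hC : ∀ x, |c x| ≤ C) {u : ∀ i, X i → ℝ}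
    (hu : ∀ x, ∑ i, u i (x i) ≤ c x) {z : ∀ i, X i} (hz : -C - 1 ≤ ∑ i, u i (z i)) :
    ∃ v ∈ boundedPotentials c (3 * C + 1), ∀ x : ∀ i, X i, ∑ i, u i (x i) ≤ ∑ i, v i (x i) := by
  have : Nonempty (∀ i, X i) := ⟨z⟩
  obtain ⟨w, huw, hw, hmod⟩ := exists_hasCostModulus_ge hu Finset.univ
  have hm' : (1 : ℝ) ≤ m := by exact_mod_cast hm
  have hC0 : 0 ≤ C := (abs_nonneg _).trans (hC z)
  set a := ∑ i, w i (z i) with ha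
  have hsum : ∀ x : ∀ i, X i, ∑ i, (w i (x i) + (a / m - w i (z i))) = ∑ i, w i (x i) := by
    intro x
    rw [Finset.sum_add_distrib, Finset.sum_sub_distrib, ← ha, Finset.sum_const, Finset.card_univ,
      Fintype.card_fin, nsmul_eq_mul, mul_div_cancel₀ _ (by positivity), sub_self, add_zero]
  have ha1 : a ≤ C := (hw z).trans (abs_le.1 (hC z)).2
  have ha2 : -C - 1 ≤ a := hz.trans (Finset.sum_le_sum fun i _ => huw i (z i))
  have ham : |a / m| ≤ C + 1 := by
    rw [abs_div, abs_of_pos (by positivity : (0 : ℝ) < m)]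
    exact (div_le_self (abs_nonneg _) hm').trans (abs_le.2 ⟨by linarith, by linarith⟩)
  -- The shifts sum to zero and make every potential equal to `a / m` at `z`. Oscillation `2 * C`
  -- plus `|a / m| ≤ C + 1` gives the radius `3 * C + 1`.
  refine ⟨fun i x => w i x + (a / m - w i (z i)), ⟨fun i x => ?_, fun x => ?_, fun i => ?_⟩,
    fun x => ?_⟩
  · have h1 := (hmod i (Finset.mem_univ i)).le_add hC x (z i)
    have h2 := (hmod i (Finset.mem_univ i)).le_add hC (z i) x
    have h3 := abs_le.1 ham
    constructor <;> linarith
  · exact (hsum x).trans_le (hw x)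
  · exact (hmod i (Finset.mem_univ i)).add_const _
  · exact (Finset.sum_le_sum fun i _ => huw i (x i)).trans_eq (hsum x).symm

end Conjugation

/-! ### Equicontinuity and dual attainment -/

section Attainment

variable {m : ℕ} {X : Fin m → Type*} [∀ i, TopologicalSpace (X i)] [∀ i, CompactSpace (X i)]
  {c : (∀ i, X i) → ℝ}

/-- Uniformity in `z` comes from compactness: the curried cost is continuous into the sup norm. -/
theorem eventually_forall_abs_update_sub_lt (hc : Continuous c) (i : Fin m) (x : X i) {ε : ℝ}
    (hε : 0 < ε) :
    ∀ᶠ y in 𝓝 x, ∀ z, |c (Function.update z i y) - c (Function.update z i x)| < ε := by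
  let F : C(X i × (∀ j, X j), ℝ) := ⟨fun p => c (Function.update p.2 i p.1), by fun_prop⟩
  filter_upwards [(Metric.tendsto_nhds.1 (F.curry.continuous.tendsto x)) ε hε] with y hy z
  exact (ContinuousMap.dist_apply_le_dist z).trans_lt hy

theorem eventually_forall_hasCostModulus (hc : Continuous c) (i : Fin m) (x : X i) {ε : ℝ}
    (hε : 0 < ε) : ∀ᶠ y in 𝓝 x, ∀ u, HasCostModulus c i u → |u y - u x| ≤ ε := by
  filter_upwards [eventually_forall_abs_update_sub_lt hc i x hε] with y hy u hu
  have h1 := hu x y ε fun z => by linarith [(abs_lt.1 (hy z)).1]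
  have h2 := hu y x ε fun z => by linarith [(abs_lt.1 (hy z)).2]
  exact abs_le.2 ⟨by linarith, by linarith⟩

theorem HasCostModulus.continuous (hc : Continuous c) {i : Fin m} {u : X i → ℝ}
    (hu : HasCostModulus c i u) : Continuous u := by
  refine continuous_iff_continuousAt.2 fun x => Metric.tendsto_nhds.2 fun ε hε => ?_
  filter_upwards [eventually_forall_hasCostModulus hc i x (half_pos hε)] with y hy
  exact (hy u hu).trans_lt (half_lt_self hε)

variable [∀ i, T2Space (X i)] [∀ i, SecondCountableTopology (X i)] [∀ i, MeasurableSpace (X i)]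
  [∀ i, BorelSpace (X i)] {μ : ∀ i, Measure (X i)} {γ : Measure (∀ i, X i)}

/-- The defect of equality of uniformly equicontinuous potentials is bounded, near a point of the
support, by the defect of their integrals. -/
theorem exists_pos_forall_mul_le_integral [IsProbabilityMeasure γ] (hm : 0 < m)
    (hc : Continuous c) {x : ∀ i, X i} (hx : x ∈ γ.support) {ε : ℝ} (hε : 0 < ε) :
    ∃ δ > 0, ∀ v : ∀ i, X i → ℝ, (∀ y, ∑ i, v i (y i) ≤ c y) →
      (∀ i, HasCostModulus c i (v i)) → ∑ i, v i (x i) + 2 * ε < c x →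
        δ ≤ ∫ y, (c y - ∑ i, v i (y i)) ∂γ := by
  have hm' : (0 : ℝ) < m := by exact_mod_cast hm
  -- On `U` the cost and the sum of the `m` potentials each move by at most `ε / 2`, so a defect
  -- above `2 * ε` at `x` stays above `ε`. The neighborhood does not depend on `v`.
  have hU : ∀ᶠ y in 𝓝 x, |c y - c x| < ε / 2 ∧ ∀ i, ∀ u, HasCostModulus c i u →
      |u (y i) - u (x i)| ≤ ε / 2 / m := by
    refine ((Metric.tendsto_nhds.1 (hc.tendsto x)) _ (half_pos hε)).and (eventually_all.2 fun i => ?_)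
    exact ((continuous_apply i).tendsto x).eventually
      (eventually_forall_hasCostModulus hc i (x i) (by positivity))
  obtain ⟨U, hUs, hUo, hxU⟩ := mem_nhds_iff.1 hU
  have hpos : 0 < γ U := (Measure.mem_support_iff_forall x).1 hx U (hUo.mem_nhds hxU)
  refine ⟨ε * γ.real U, mul_pos hε (ENNReal.toReal_pos hpos.ne' (measure_ne_top _ _)),
    fun v hv hmod hvx => ?_⟩
  have hcont : Continuous fun y => c y - ∑ i, v i (y i) :=
    hc.sub (continuous_finsetSum _ fun i _ => ((hmod i).continuous hc).comp (continuous_apply i))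
  have hint := hcont.integrable_of_hasCompactSupport (μ := γ) (HasCompactSupport.of_compactSpace _)
  calc ε * γ.real U = ∫ _ in U, ε ∂γ := by simp [mul_comm]
    _ ≤ ∫ y in U, (c y - ∑ i, v i (y i)) ∂γ := by
      refine setIntegral_mono_on (integrable_const _).integrableOn hint.integrableOn
        hUo.measurableSet fun y hy => ?_
      obtain ⟨h1, h2⟩ := hUs hy
      have h3 : ∑ i, v i (y i) ≤ ∑ i, (v i (x i) + ε / 2 / m) := Finset.sum_le_sum fun i _ => by
        linarith [(abs_le.1 (h2 i (v i) (hmod i))).2]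
      rw [Finset.sum_add_distrib, Finset.sum_const, Finset.card_univ, Fintype.card_fin,
        nsmul_eq_mul, mul_div_cancel₀ _ hm'.ne'] at h3
      linarith [(abs_lt.1 h1).1]
    _ ≤ ∫ y, (c y - ∑ i, v i (y i)) ∂γ :=
      setIntegral_le_integral hint (ae_of_all _ fun y => sub_nonneg.2 (hv y))

/-- Dual attainment on compact spaces. -/
theorem IsOptimal.exists_continuous_potentials (hm : 0 < m) (hc : Continuous c)
    (h : IsOptimal c μ γ) : ∃ v : ∀ i, X i → ℝ, (∀ i, Continuous (v i)) ∧
      (∀ x, ∑ i, v i (x i) ≤ c x) ∧ ∀ x ∈ γ.support, ∑ i, v i (x i) = c x := by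
  have := h.1.1
  have hintc := hc.integrable_of_hasCompactSupport (μ := γ) (HasCompactSupport.of_compactSpace _)
  set C := ‖(⟨c, hc⟩ : C(∀ i, X i, ℝ))‖
  have hC : ∀ x, |c x| ≤ C := fun x => ContinuousMap.norm_coe_le_norm ⟨c, hc⟩ x
  have hseq : ∀ n : ℕ, ∃ v ∈ boundedPotentials c (3 * C + 1),
      ∫ x, (c x - ∑ i, v i (x i)) ∂γ ≤ 1 / ((n : ℝ) + 1) := by
    intro n
    have hn : (0 : ℝ) < 1 / ((n : ℝ) + 1) := by positivity
    obtain ⟨u, hu, hlt⟩ := h.exists_continuousMap_integral_lt hm hc hn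
    have hui := fun i => h.1.integrable_continuousMap i (u i)
    rw [← h.1.integral_sum hui] at hlt
    have huint := h.1.integrable_sum hui
    -- Otherwise the dual value would be at most `-C - 1`, hence at least `1` below the primal
    -- value.
    obtain ⟨z, hz⟩ : ∃ z : ∀ i, X i, -C - 1 ≤ ∑ i, u i (z i) := by
      by_contra! hcon
      have h1 : ∫ x, ∑ i, u i (x i) ∂γ ≤ ∫ _, (-C - 1) ∂γ :=
        integral_mono huint (integrable_const _) fun x => (hcon x).le
      have h2 : ∫ _, -C ∂γ ≤ ∫ x, c x ∂γ :=
        integral_mono (integrable_const _) hintc fun x => (abs_le.1 (hC x)).1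
      simp only [integral_const, probReal_univ, one_smul] at h1 h2
      have h3 : 1 / ((n : ℝ) + 1) ≤ 1 := by
        rw [div_le_one (by positivity)]
        simp
      linarith
    obtain ⟨v, hv, huv⟩ := exists_mem_boundedPotentials_ge (u := fun i => u i) hm hC hu hz
    have hvint : Integrable (fun x : ∀ i, X i => ∑ i, v i (x i)) γ :=
      (continuous_finsetSum _ fun i _ => ((hv.2.2 i).continuous hc).comp
        (continuous_apply i)).integrable_of_hasCompactSupport (HasCompactSupport.of_compactSpace _)
    refine ⟨v, hv, ?_⟩
    rw [integral_sub hintc hvint]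
    have := integral_mono huint hvint huv
    linarith
  choose v hv hvint using hseq
  -- A cluster point replaces a subsequence: pointwise convergence on an uncountable space need not
  -- be sequentially compact.
  obtain ⟨w, hw, hcl⟩ := (isCompact_boundedPotentials c (3 * C + 1)).exists_mapClusterPt
    (f := atTop) (u := v) (tendsto_principal.2 (Eventually.of_forall hv))
  refine ⟨w, fun i => (hw.2.2 i).continuous hc, hw.2.1, fun x hx => (hw.2.1 x).antisymm ?_⟩
  by_contra! hlt
  obtain ⟨δ, hδ, hbound⟩ := exists_pos_forall_mul_le_integral hm hc hx
    (ε := (c x - ∑ i, w i (x i)) / 4) (by linarith)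
  have hnhds : ∀ᶠ w' in 𝓝 w, ∑ i, w' i (x i) + 2 * ((c x - ∑ i, w i (x i)) / 4) < c x := by
    have hcont : Continuous fun w' : ∀ i, X i → ℝ =>
        ∑ i, w' i (x i) + 2 * ((c x - ∑ i, w i (x i)) / 4) := by fun_prop
    exact hcont.continuousAt.eventually_lt continuousAt_const (by linarith)
  have hsmall : ∀ᶠ n : ℕ in atTop, 1 / ((n : ℝ) + 1) < δ :=
    tendsto_one_div_add_atTop_nhds_zero_nat.eventually_lt_const hδ
  obtain ⟨n, hn, hn'⟩ := ((hcl.frequently hnhds).and_eventually hsmall).exists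
  exact absurd (hbound (v n) (hv n).2.1 (hv n).2.2 hn) (not_le.2 ((hvint n).trans_lt hn'))

end Attainment

theorem IsSplittingSet.isCyclicallyMonotone {m : ℕ} {M : Fin m → Type*}
    [∀ i, MeasurableSpace (M i)] {c : (∀ i, M i) → ℝ} {S : Set (∀ i, M i)}
    (h : IsSplittingSet c S) : IsCyclicallyMonotone c S := by
  obtain ⟨u, -, hle, heq⟩ := h
  intro N x hx σ
  calc ∑ k, c (x k) = ∑ k, ∑ i, u i (x k i) := Finset.sum_congr rfl fun k _ => (heq _ (hx k)).symm
    _ = ∑ i, ∑ k, u i (x k i) := Finset.sum_comm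
    _ = ∑ i, ∑ k, u i (x (σ i k) i) := Finset.sum_congr rfl fun i _ =>
      (Equiv.sum_comp (σ i) fun k => u i (x k i)).symm
    _ = ∑ k, ∑ i, u i (x (σ i k) i) := Finset.sum_comm
    _ ≤ ∑ k, c (fun j => x (σ j k) j) := Finset.sum_le_sum fun k _ => hle _

theorem IsCoupling.ae_forall_mem {m : ℕ} {M : Fin m → Type*} [∀ i, MeasurableSpace (M i)]
    {μ : ∀ i, Measure (M i)} {γ : Measure (∀ i, M i)} (h : IsCoupling μ γ) {K : ∀ i, Set (M i)}
    (hK : ∀ i, ∀ᵐ x ∂μ i, x ∈ K i) : ∀ᵐ x ∂γ, ∀ i, x i ∈ K i :=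
  ae_all_iff.2 fun i => (h.measurePreserving i).quasiMeasurePreserving.ae (hK i)

/-! ### Extension from compact sets to the whole spaces -/

section Extension

variable {m : ℕ} {M : Fin m → Type*} [∀ i, TopologicalSpace (M i)] [∀ i, T2Space (M i)]
  [∀ i, SigmaCompactSpace (M i)] [∀ i, MeasurableSpace (M i)] [∀ i, BorelSpace (M i)]

/-- Potentials on compact subsets extend to Borel potentials on the whole spaces, which decay fast
enough outside the compact sets to stay below the cost. -/
theorem exists_measurable_extension {c : (∀ i, M i) → ℝ} (hc : Continuous c) {K : ∀ i, Set (M i)}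
    (hK : ∀ i, IsCompact (K i)) {v : ∀ i, K i → ℝ} (hv : ∀ i, Continuous (v i))
    (hvc : ∀ x : ∀ i, K i, ∑ i, v i (x i) ≤ c (fun i => x i)) :
    ∃ u : ∀ i, M i → ℝ, (∀ i, Measurable (u i)) ∧ (∀ x, ∑ i, u i (x i) ≤ c x) ∧
      ∀ i (x : K i), u i x = v i x := by
  have hm0 : (0 : ℝ) ≤ m := Nat.cast_nonneg m
  have hcov : ∀ i (x : M i), ∃ n, x ∈ K i ∪ compactCovering (M i) n := fun i x =>
    (exists_mem_compactCovering x).imp fun _ hn => Or.inr hn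
  have hcovc : ∀ i n, IsCompact (K i ∪ compactCovering (M i) n) := fun i n =>
    (hK i).union (isCompact_compactCovering _ n)
  have hA : ∀ n, ∃ A, 0 ≤ A ∧ ∀ x : ∀ i, M i, (∀ i, x i ∈ K i ∪ compactCovering (M i) n) →
      -A ≤ c x := by
    intro n
    obtain ⟨A, hA⟩ := (isCompact_univ_pi fun i => hcovc i n).exists_bound_of_continuousOn
      hc.continuousOn
    refine ⟨max A 0, le_max_right _ _, fun x hx => ?_⟩
    have h1 := (abs_le.1 (hA x fun i _ => hx i)).1
    linarith [le_max_left A 0]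
  choose A hA0 hA using hA
  have hB : ∀ i, ∃ B, ∀ x, v i x ≤ B := fun i => by
    have := isCompact_iff_compactSpace.1 (hK i)
    obtain ⟨B, hB⟩ := isCompact_univ.exists_bound_of_continuousOn (hv i).continuousOn
    exact ⟨B, fun x => (le_abs_self _).trans (hB x trivial)⟩
  choose B' hB' using hB
  obtain ⟨B, hB0, hB⟩ : ∃ B : ℝ, 0 ≤ B ∧ ∀ i x, v i x ≤ B :=
    ⟨∑ i, |B' i|, Finset.sum_nonneg fun i _ => abs_nonneg _, fun i x => (hB' i x).trans
      ((le_abs_self _).trans (Finset.single_le_sum (f := fun i => |B' i|)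
        (fun j _ => abs_nonneg _) (Finset.mem_univ i)))⟩
  classical
  let rank : ∀ i, M i → ℕ := fun i x => Nat.find (hcov i x)
  have hrank : ∀ i x, x ∈ K i ∪ compactCovering (M i) (rank i x) := fun i x =>
    Nat.find_spec (hcov i x)
  -- Here `A n` compensates for the negative part of `c` on the `n`-th compact box, and `m * B` for
  -- the other potentials.
  let u : ∀ i, M i → ℝ := fun i =>
    Function.extend Subtype.val (v i) fun x => -(A (rank i x) + m * B)
  have huK : ∀ i (x : K i), u i x = v i x := fun i x =>
    Subtype.val_injective.extend_apply _ _ x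
  have huK' : ∀ i x, x ∉ K i → u i x = -(A (rank i x) + m * B) := fun i x hx =>
    Function.extend_apply' _ _ _ fun ⟨y, hy⟩ => hx (hy ▸ y.2)
  have huB : ∀ i x, u i x ≤ B := by
    intro i x
    by_cases hx : x ∈ K i
    · exact (huK i ⟨x, hx⟩).trans_le (hB i _)
    · rw [huK' i x hx]
      have := hA0 (rank i x)
      have := mul_nonneg hm0 hB0
      linarith
  refine ⟨u, fun i => ?_, fun x => ?_, huK⟩
  · refine (MeasurableEmbedding.subtype_coe (hK i).measurableSet).measurable_extend
      (hv i).measurable ?_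
    have hr : Measurable (rank i) := measurable_find (hcov i) fun n => (hcovc i n).measurableSet
    exact (((measurable_of_countable A).comp hr).add_const _).neg
  · by_cases hx : ∀ i, x i ∈ K i
    · calc ∑ i, u i (x i) = ∑ i, v i ⟨x i, hx i⟩ :=
            Finset.sum_congr rfl fun i _ => huK i ⟨x i, hx i⟩
        _ ≤ c x := hvc fun i => ⟨x i, hx i⟩
    · push Not at hx
      -- The outside coordinate of largest rank fixes a box containing all of `x`; its potential
      -- alone pays for the whole inequality.
      obtain ⟨i, hi, himax⟩ := (Finset.univ.filter fun i => x i ∉ K i).exists_max_image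
        (fun i => rank i (x i)) (by simpa [Finset.Nonempty] using hx)
      simp only [Finset.mem_filter, Finset.mem_univ, true_and] at hi himax
      have hmem : ∀ j, x j ∈ K j ∪ compactCovering (M j) (rank i (x i)) := by
        intro j
        by_cases hj : x j ∈ K j
        · exact Or.inl hj
        · exact (hrank j (x j)).imp_right fun h => compactCovering_subset _ (himax j hj) h
      refine le_trans ?_ (hA _ x hmem)
      rw [← Finset.add_sum_erase _ _ (Finset.mem_univ i), huK' i _ hi]
      have hsum : ∑ j ∈ Finset.univ.erase i, u j (x j) ≤ m * B := by
        calc ∑ j ∈ Finset.univ.erase i, u j (x j) ≤ ∑ _j ∈ Finset.univ.erase i, B :=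
              Finset.sum_le_sum fun j _ => huB j _
          _ ≤ ∑ _j : Fin m, B := Finset.sum_le_sum_of_subset_of_nonneg (Finset.subset_univ _)
              fun _ _ _ => hB0
          _ = m * B := by simp
      linarith

end Extension

theorem isClosedEmbedding_pi_subtype_val {m : ℕ} {M : Fin m → Type*}
    [∀ i, TopologicalSpace (M i)] [∀ i, T2Space (M i)] {K : ∀ i, Set (M i)} (hK : ∀ i, IsCompact (K i)) :
    IsClosedEmbedding fun (x : ∀ i, K i) i => (x i : M i) := by
  have := fun i => isCompact_iff_compactSpace.1 (hK i)
  refine Continuous.isClosedEmbedding (by fun_prop) fun x y hxy => ?_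
  funext i
  exact Subtype.ext (congrFun hxy i)

theorem IsCoupling.map_pi_subtype_val {m : ℕ} {M : Fin m → Type*}
    [∀ i, MeasurableSpace (M i)] {K : ∀ i, Set (M i)} {ν : ∀ i, Measure (K i)}
    {η : Measure (∀ i, K i)} (h : IsCoupling ν η) :
    IsCoupling (fun i => (ν i).map Subtype.val)
      (η.map fun (x : ∀ i, K i) i => (x i : M i)) := by
  have hmeas : Measurable fun (x : ∀ i, K i) i => (x i : M i) := by fun_prop
  have := h.1
  refine ⟨Measure.isProbabilityMeasure_map hmeas.aemeasurable, fun i => ?_⟩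
  change _ = (ν i).map Subtype.val
  rw [← h.2 i, Measure.map_map (measurable_pi_apply i) hmeas,
    Measure.map_map measurable_subtype_coe (measurable_pi_apply i)]
  rfl

/-! ### Optimality and splitting of the support -/

section Splitting

variable {m : ℕ} {M : Fin m → Type*} [∀ i, TopologicalSpace (M i)]
  [∀ i, SecondCountableTopology (M i)] [∀ i, MeasurableSpace (M i)]
  {c : (∀ i, M i) → ℝ} {μ : ∀ i, Measure (M i)} {γ : Measure (∀ i, M i)}

theorem IsCoupling.support_subset_pi (h : IsCoupling μ γ) :
    γ.support ⊆ Set.univ.pi fun i => (μ i).support :=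
  Measure.support_subset_of_isClosed (isClosed_set_pi fun _ _ => Measure.isClosed_support) <| by
    filter_upwards [h.ae_forall_mem fun i => Measure.support_mem_ae (μ := μ i)] with x hx i _
    exact hx i

theorem IsCoupling.isCompact_support (h : IsCoupling μ γ)
    (hμ : ∀ i, IsCompact (μ i).support) : IsCompact γ.support :=
  (isCompact_univ_pi hμ).of_isClosed_subset Measure.isClosed_support h.support_subset_pi

variable [∀ i, BorelSpace (M i)]

theorem IsCoupling.integrable_of_isCompact_support (h : IsCoupling μ γ)
    (hμ : ∀ i, IsCompact (μ i).support) (hc : Continuous c) : Integrable c γ := by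
  have := h.1
  obtain ⟨C, hC⟩ := (h.isCompact_support hμ).exists_bound_of_continuousOn hc.continuousOn
  refine Integrable.of_bound hc.aestronglyMeasurable C ?_
  filter_upwards [Measure.support_mem_ae (μ := γ)] with x hx using hC x hx

variable [∀ i, T2Space (M i)]

/-- Freezing the other coordinates at a support point bounds each `u j` above on the projected
support; equality on the support then bounds `u i` below. -/
theorem IsCoupling.integrable_of_eq_on_support (h : IsCoupling μ γ)
    (hμ : ∀ i, IsCompact (μ i).support) (hc : Continuous c) {u : ∀ i, M i → ℝ}
    (hu : ∀ i, Measurable (u i)) (hle : ∀ x, ∑ i, u i (x i) ≤ c x)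
    (heq : ∀ x ∈ γ.support, ∑ i, u i (x i) = c x) (i : Fin m) : Integrable (u i) (μ i) := by
  have := h.1
  have hprob := h.isProbabilityMeasure_marginal
  have hS := h.isCompact_support hμ
  obtain ⟨z, hz⟩ := Measure.nonempty_support (IsProbabilityMeasure.ne_zero γ)
  have hupper : ∀ j, ∃ B, ∀ y ∈ (fun x : ∀ i, M i => x j) '' γ.support, u j y ≤ B := by
    intro j
    have hcont : Continuous fun y => c (Function.update z j y) -
        ∑ l ∈ Finset.univ.erase j, u l (z l) := by fun_prop
    obtain ⟨B, hB⟩ := (hS.image (continuous_apply j)).exists_bound_of_continuousOn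
      hcont.continuousOn
    exact ⟨B, fun y hy => (le_sub_sum_erase hle j y z).trans ((le_abs_self _).trans (hB y hy))⟩
  choose B hB using hupper
  obtain ⟨C, hC⟩ := hS.exists_bound_of_continuousOn hc.continuousOn
  have hbound : ∀ y ∈ (fun x : ∀ i, M i => x i) '' γ.support,
      ‖u i y‖ ≤ max (B i) (C + ∑ j ∈ Finset.univ.erase i, B j) := by
    rintro _ ⟨x, hx, rfl⟩
    have h1 := heq x hx
    rw [← Finset.add_sum_erase _ _ (Finset.mem_univ i)] at h1
    have h2 : ∑ j ∈ Finset.univ.erase i, u j (x j) ≤ ∑ j ∈ Finset.univ.erase i, B j :=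
      Finset.sum_le_sum fun j _ => hB j _ ⟨x, hx, rfl⟩
    have h3 := (abs_le.1 (hC x hx)).1
    refine abs_le.2 ⟨?_, (hB i _ ⟨x, hx, rfl⟩).trans (le_max_left _ _)⟩
    have h4 := le_max_right (B i) (C + ∑ j ∈ Finset.univ.erase i, B j)
    linarith
  refine Integrable.of_bound (hu i).aestronglyMeasurable
    (max (B i) (C + ∑ j ∈ Finset.univ.erase i, B j)) ?_
  have hmeas : MeasurableSet ((fun x : ∀ i, M i => x i) '' γ.support) :=
    (hS.image (continuous_apply i)).measurableSet
  have hae : ∀ᵐ y ∂μ i, y ∈ (fun x : ∀ i, M i => x i) '' γ.support := by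
    rw [← h.2 i]
    refine (ae_map_iff (measurable_pi_apply i).aemeasurable hmeas).2 ?_
    filter_upwards [Measure.support_mem_ae (μ := γ)] with x hx using ⟨x, hx, rfl⟩
  filter_upwards [hae] with y hy using hbound y hy

theorem IsCoupling.isOptimal_of_isSplittingSet (h : IsCoupling μ γ)
    (hμ : ∀ i, IsCompact (μ i).support) (hc : Continuous c) (hs : IsSplittingSet c γ.support) :
    IsOptimal c μ γ := by
  obtain ⟨u, hu, hle, heq⟩ := hs
  have hint := h.integrable_of_eq_on_support hμ hc hu hle heq
  refine ⟨h, fun η hη => ?_⟩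
  calc ∫ x, c x ∂γ = ∫ x, ∑ i, u i (x i) ∂γ := integral_congr_ae <| by
        filter_upwards [Measure.support_mem_ae (μ := γ)] with x hx using (heq x hx).symm
    _ = ∫ x, ∑ i, u i (x i) ∂η := by rw [h.integral_sum hint, hη.integral_sum hint]
    _ ≤ ∫ x, c x ∂η := integral_mono (hη.integrable_sum hint)
        (hη.integrable_of_isCompact_support hμ hc) hle

theorem IsOptimal.isSplittingSet_support [∀ i, SigmaCompactSpace (M i)] (hm : 0 < m)
    (h : IsOptimal c μ γ) (hμ : ∀ i, IsCompact (μ i).support) (hc : Continuous c) :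
    IsSplittingSet c γ.support := by
  have := h.1.1
  have := fun i => isCompact_iff_compactSpace.1 (hμ i)
  set f : (∀ i, (μ i).support) → ∀ i, M i := fun x i => x i
  have hfe : IsClosedEmbedding f := isClosedEmbedding_pi_subtype_val hμ
  have hfm : MeasurableEmbedding f := hfe.measurableEmbedding
  have hrange : ∀ᵐ x ∂γ, x ∈ Set.range f := by
    filter_upwards [h.1.ae_forall_mem fun i => Measure.support_mem_ae (μ := μ i)] with x hx
    exact ⟨fun i => ⟨x i, hx i⟩, rfl⟩
  have hmap : (γ.comap f).map f = γ := by
    rw [hfm.map_comap, Measure.restrict_eq_self_of_ae_mem hrange]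
  set ν : ∀ i, Measure (μ i).support := fun i => (γ.comap f).map fun x => x i
  have hprob : IsProbabilityMeasure (γ.comap f) := by
    rw [← Measure.isProbabilityMeasure_map_iff hfm.measurable.aemeasurable, hmap]
    infer_instance
  have hcoup : IsCoupling ν (γ.comap f) := ⟨hprob, fun _ => rfl⟩
  have hνμ : ∀ i, (ν i).map Subtype.val = μ i := fun i => by
    refine (hcoup.map_pi_subtype_val.2 i).symm.trans ?_
    rw [← h.1.2 i]
    exact congrArg _ hmap
  have hopt : IsOptimal (c ∘ f) ν (γ.comap f) := by
    refine ⟨hcoup, fun η hη => ?_⟩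
    have hle := h.2 (η.map f) (by simpa only [hνμ] using hη.map_pi_subtype_val)
    rw [hfm.integral_map] at hle
    refine le_of_eq_of_le ?_ hle
    conv_rhs => rw [← hmap]
    exact (hfm.integral_map c).symm
  obtain ⟨v, hv, hvc, hveq⟩ := hopt.exists_continuous_potentials hm (hc.comp hfe.continuous)
  obtain ⟨u, hu, huc, huv⟩ := exists_measurable_extension hc hμ hv hvc
  refine ⟨u, hu, huc, fun x hx => ?_⟩
  obtain ⟨y, rfl⟩ : x ∈ Set.range f :=
    ⟨fun i => ⟨x i, h.1.support_subset_pi hx i trivial⟩, rfl⟩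
  -- Neighborhoods of `y` contain preimages of neighborhoods of `f y`, and `γ` is carried by the
  -- range of `f`.
  have hy : y ∈ (γ.comap f).support := by
    refine (Measure.mem_support_iff_forall y).2 fun U hU => ?_
    rw [hfe.isInducing.nhds_eq_comap] at hU
    obtain ⟨V, hV, hVU⟩ := hU
    refine ((Measure.mem_support_iff_forall _).1 hx V hV).trans_le ?_
    rw [← hmap, hfm.map_apply, hmap]
    exact measure_mono hVU
  rw [← Function.comp_apply (f := c), ← hveq y hy]
  exact Finset.sum_congr rfl fun i _ => huv i (y i)

end Splitting

end MultiMarginal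

theorem proposition2p3 {m : ℕ} (hm : 1 ≤ m)
    {E : Fin m → Type*} [∀ i, NormedAddCommGroup (E i)] [∀ i, NormedSpace ℝ (E i)]
    [∀ i, FiniteDimensional ℝ (E i)]
    {H : Fin m → Type*} [∀ i, TopologicalSpace (H i)]
    (I : ∀ i, ModelWithCorners ℝ (E i) (H i))
    {M : Fin m → Type*} [∀ i, TopologicalSpace (M i)] [∀ i, ChartedSpace (H i) (M i)]
    [∀ i, IsManifold (I i) ∞ (M i)] [∀ i, T2Space (M i)] [∀ i, SecondCountableTopology (M i)]
    [∀ i, MeasurableSpace (M i)] [∀ i, BorelSpace (M i)]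
    (c : (∀ i, M i) → ℝ) (hc : Continuous c) :
    (∀ γ : Measure (∀ i, M i), IsProbabilityMeasure γ →
      (∀ i, IsCompact (γ.map (fun x : ∀ j, M j => x i)).support) →
      (MultiMarginal.IsOptimal c (fun i => γ.map (fun x : ∀ j, M j => x i)) γ ↔
        MultiMarginal.IsSplittingSet c γ.support)) ∧
    ∀ S : Set (∀ i, M i), MultiMarginal.IsSplittingSet c S →
      MultiMarginal.IsCyclicallyMonotone c S := by
  -- Local compactness and second countability give the σ-compactness used in the extension.
  have := fun i => Manifold.locallyCompact_of_finiteDimensional (M := M i) (I i)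
  refine ⟨fun γ hγ hμ => ⟨fun h => h.isSplittingSet_support hm hμ hc, fun h => ?_⟩,
    fun S hS => hS.isCyclicallyMonotone⟩
  exact MultiMarginal.IsCoupling.isOptimal_of_isSplittingSet ⟨hγ, fun _ => rfl⟩ hμ hc h
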